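/- Let $a\ge -1$ be an integer, let $\rho$ be the largest real root of $x^3-ax^2-(a+3)x-1$, let $K=\mathbb Q(\rho)$ (a totally real cubic field), and assume that its ring of integers is $\mathcal O_K=\mathbb Z[\rho]$. An element $x\in K$ is called totally positive if $\sigma(x)>0$ for every embedding $\sigma:K\hookrightarrow\mathbb R$, and an element $\alpha\in\mathcal O_K$ is called indecomposable if it is totally positive and cannot be written as $\alpha=\beta+\gamma$ with totally positive $\beta,\gamma\in\mathcal O_K$. Then, up to multiplication by totally positive units of $\mathcal O_K$, the indecomposable elements of $\mathcal O_K$ are precisely $$1,\qquad 1+\rho+\rho^2,\qquad -v-w\rho+(v+1)\rho^2\quad\text{with } v,w\in\mathbb Z,\ 0\le v\le a,\ v(a+2)+1\le w\le (v+1)(a+1).$$ That is, $\alpha\in\mathcal O_K$ is indecomposable if and only if $\alpha=\varepsilon x$ for a totally positive unit $\varepsilon\in\mathcal O_K^\times$ and some $x$ in this list. -/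

import Mathlib

open scoped IntermediateField NumberField

/-- `ρ` is the largest real root of `x³ - a x² - (a + 3) x - 1`. -/
def IsSimplestCubicRoot (a : ℤ) (ρ : ℝ) : Prop :=
  IsGreatest {x : ℝ | x ^ 3 - (a : ℝ) * x ^ 2 - ((a : ℝ) + 3) * x - 1 = 0} ρ

/-- An element of a (totally real) field is totally positive if its image under every
embedding of the field into `ℝ` is positive. -/
def IsTotallyPositive {K : Type*} [Field K] (x : K) : Prop :=
  ∀ σ : K →+* ℝ, 0 < σ x

/-- An element of the ring of integers of a (totally real) number field is indecomposable if it
is totally positive and is not a sum of two totally positive algebraic integers. -/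
def IsIndecomposable {K : Type*} [Field K] (α : 𝓞 K) : Prop :=
  IsTotallyPositive (α : K) ∧
    ¬ ∃ β γ : 𝓞 K, IsTotallyPositive (β : K) ∧ IsTotallyPositive (γ : K) ∧ α = β + γ

/-- The list `1`, `1 + ρ + ρ²`, `-v - w ρ + (v + 1) ρ²` with `0 ≤ v ≤ a` and
`v (a + 2) + 1 ≤ w ≤ (v + 1) (a + 1)`. -/
def simplestCubicList {K : Type*} [Field K] (a : ℤ) (ρ : K) : Set K :=
  {1, 1 + ρ + ρ ^ 2} ∪
    {x | ∃ v w : ℤ, 0 ≤ v ∧ v ≤ a ∧ v * (a + 2) + 1 ≤ w ∧ w ≤ (v + 1) * (a + 1) ∧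
      x = -(v : K) - (w : K) * ρ + ((v : K) + 1) * ρ ^ 2}

/-! ### Total positivity and association by totally positive units. -/

section TotallyPositive

variable {K : Type*} [Field K]

/-! In the basis 1, θ, θ² of ℤ[θ] take the functionals L₁ = x + z and L₂ = 2x - y + 2z. They are the
traces against ((1+ρ)/(1+ρ+ρ²))² and 1/(1+ρ+ρ²), which are totally positive, so both are positive
integers on totally positive integers (`functionals_pos`).

L₁ is 1 on the unit squares 1, θ², θ²/(1+θ)², and L₂ is 2 on 1, θ², (1+θ)². Among the totally
positive associates of α, choose one where 2L₁ or L₂ is smallest. Comparing it with neighbouring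
associates places it in the simplicial cone over the corresponding triple
(`exists_totallyPositiveAssociated_inCone`). An indecomposable in a cone, unless it is a generator,
cannot have a generator subtracted within the cone. In the first cone this leaves only 1 + θ + θ².
In the second it leaves heights L₁ = 1 and 2; height 2 splits into two points of height 1, and those
of height 1 are the vertices and the listed family.

Conversely, L₁ = 1 forces indecomposability by integrality. Only 1 + θ + θ², where L₁ = 2 and L₂ =
3, needs estimates on the real conjugates (`not_isTotallyPositive_complement`). -/

theorem IsTotallyPositive.add {x y : K} (hx : IsTotallyPositive x) (hy : IsTotallyPositive y) :
    IsTotallyPositive (x + y) := fun σ => by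
  rw [map_add]; exact add_pos (hx σ) (hy σ)

theorem IsTotallyPositive.mul {x y : K} (hx : IsTotallyPositive x) (hy : IsTotallyPositive y) :
    IsTotallyPositive (x * y) := fun σ => by
  rw [map_mul]; exact mul_pos (hx σ) (hy σ)

theorem isTotallyPositive_sq {x : K} (hx : x ≠ 0) : IsTotallyPositive (x ^ 2) := fun σ => by
  rw [map_pow]; exact sq_pos_of_ne_zero ((map_ne_zero σ).2 hx)

theorem isTotallyPositive_one : IsTotallyPositive (1 : K) := fun σ => by simp

/-- A nonzero sum of nonnegative integral multiples of totally positive elements, divided by a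
positive integer, is totally positive. -/
theorem IsTotallyPositive.of_intCast_mul_eq {D c₁ c₂ c₃ : ℤ} {x u₁ u₂ u₃ : K}
    (hu₁ : IsTotallyPositive u₁) (hu₂ : IsTotallyPositive u₂) (hu₃ : IsTotallyPositive u₃)
    (hD : 0 < D) (h₁ : 0 ≤ c₁) (h₂ : 0 ≤ c₂) (h₃ : 0 ≤ c₃) (hc : 0 < c₁ + c₂ + c₃)
    (h : (D : K) * x = c₁ * u₁ + c₂ * u₂ + c₃ * u₃) : IsTotallyPositive x := fun σ => by
  have key : (D : ℝ) * σ x = c₁ * σ u₁ + c₂ * σ u₂ + c₃ * σ u₃ := by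
    simpa using congrArg σ h
  have hD' : (0 : ℝ) < D := by exact_mod_cast hD
  have h₁' : (0 : ℝ) ≤ c₁ := by exact_mod_cast h₁
  have h₂' : (0 : ℝ) ≤ c₂ := by exact_mod_cast h₂
  have h₃' : (0 : ℝ) ≤ c₃ := by exact_mod_cast h₃
  have p₁ := mul_nonneg h₁' (hu₁ σ).le
  have p₂ := mul_nonneg h₂' (hu₂ σ).le
  have p₃ := mul_nonneg h₃' (hu₃ σ).le
  have : 0 < (c₁ : ℝ) * σ u₁ + c₂ * σ u₂ + c₃ * σ u₃ := by
    rcases (by omega : 0 < c₁ ∨ 0 < c₂ ∨ 0 < c₃) with q | q | q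
    · have : (0 : ℝ) < c₁ := by exact_mod_cast q
      have := mul_pos this (hu₁ σ)
      linarith
    · have : (0 : ℝ) < c₂ := by exact_mod_cast q
      have := mul_pos this (hu₂ σ)
      linarith
    · have : (0 : ℝ) < c₃ := by exact_mod_cast q
      have := mul_pos this (hu₃ σ)
      linarith
  rw [← key] at this
  exact pos_of_mul_pos_right this hD'.le

/-- Two algebraic integers are associated when they differ by a totally positive unit. -/
def TotallyPositiveAssociated (α β : 𝓞 K) : Prop :=
  ∃ ε : (𝓞 K)ˣ, IsTotallyPositive ((ε : 𝓞 K) : K) ∧ α = ε * β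

theorem IsTotallyPositive.coe_mul {α β : 𝓞 K} (hα : IsTotallyPositive (α : K))
    (hβ : IsTotallyPositive (β : K)) : IsTotallyPositive ((α * β : 𝓞 K) : K) := by
  change IsTotallyPositive (algebraMap (𝓞 K) K (α * β))
  rw [map_mul]
  exact hα.mul hβ

theorem IsTotallyPositive.unit_inv {ε : (𝓞 K)ˣ} (h : IsTotallyPositive ((ε : 𝓞 K) : K)) :
    IsTotallyPositive (((ε⁻¹ : (𝓞 K)ˣ) : 𝓞 K) : K) := fun σ => by
  have h1 : ((ε : 𝓞 K) : K) * (((ε⁻¹ : (𝓞 K)ˣ) : 𝓞 K) : K) = 1 := by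
    rw [← map_mul, Units.mul_inv, map_one]
  have h2 : σ ((ε : 𝓞 K) : K) * σ (((ε⁻¹ : (𝓞 K)ˣ) : 𝓞 K) : K) = 1 := by
    rw [← map_mul, h1, map_one]
  exact pos_of_mul_pos_right (h2 ▸ one_pos) (h σ).le

theorem isTotallyPositive_unit_sq (u : (𝓞 K)ˣ) :
    IsTotallyPositive (((u ^ 2 : (𝓞 K)ˣ) : 𝓞 K) : K) := by
  rw [Units.val_pow_eq_pow_val]
  change IsTotallyPositive (algebraMap (𝓞 K) K ((u : 𝓞 K) ^ 2))
  rw [map_pow]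
  refine isTotallyPositive_sq fun h => u.ne_zero ?_
  exact NumberField.RingOfIntegers.coe_eq_zero_iff.1 h

namespace TotallyPositiveAssociated

theorem refl (α : 𝓞 K) : TotallyPositiveAssociated α α :=
  ⟨1, by simpa using isTotallyPositive_one, by simp⟩

theorem symm {α β : 𝓞 K} (h : TotallyPositiveAssociated α β) :
    TotallyPositiveAssociated β α := by
  obtain ⟨ε, hε, rfl⟩ := h
  exact ⟨ε⁻¹, hε.unit_inv, by simp⟩

theorem trans {α β γ : 𝓞 K} (h : TotallyPositiveAssociated α β)
    (h' : TotallyPositiveAssociated β γ) : TotallyPositiveAssociated α γ := by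
  obtain ⟨ε, hε, rfl⟩ := h
  obtain ⟨η, hη, rfl⟩ := h'
  refine ⟨ε * η, ?_, by rw [Units.val_mul, mul_assoc]⟩
  rw [Units.val_mul]
  exact hε.coe_mul hη

theorem unit_sq_mul (u : (𝓞 K)ˣ) (α : 𝓞 K) :
    TotallyPositiveAssociated ((u : 𝓞 K) ^ 2 * α) α :=
  ⟨u ^ 2, isTotallyPositive_unit_sq u, by simp⟩

theorem isTotallyPositive {α β : 𝓞 K} (h : TotallyPositiveAssociated α β)
    (hβ : IsTotallyPositive (β : K)) : IsTotallyPositive (α : K) := by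
  obtain ⟨ε, hε, rfl⟩ := h
  exact hε.coe_mul hβ

theorem isIndecomposable {α β : 𝓞 K} (h : TotallyPositiveAssociated α β)
    (hβ : IsIndecomposable β) : IsIndecomposable α := by
  refine ⟨h.isTotallyPositive hβ.1, ?_⟩
  rintro ⟨γ, δ, hγ, hδ, e⟩
  obtain ⟨ε, hε, rfl⟩ := h.symm
  refine hβ.2 ⟨ε * γ, ε * δ, ?_, ?_, by rw [e, mul_add]⟩
  · exact hε.coe_mul hγ
  · exact hε.coe_mul hδ

end TotallyPositiveAssociated

end TotallyPositive

/-- The element `x + y θ + z θ²`. -/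
def quadraticCombination {R : Type*} [CommRing R] (θ : R) (x y z : ℤ) : R :=
  (x : R) + y * θ + z * θ ^ 2

/-! ### Reduction to two simplicial cones. -/

section Reduction

variable {K : Type*} [Field K] {a : ℤ} {θ : 𝓞 K}

theorem quadraticCombination_mul {R : Type*} [CommRing R] {θ : R} {a : ℤ}
    (h : θ ^ 3 = a * θ ^ 2 + (a + 3) * θ + 1) (p q r x y z : ℤ) :
    quadraticCombination θ p q r * quadraticCombination θ x y z =
      quadraticCombination θ
        (p * x + (q * z + r * y + a * (r * z)))
        (p * y + q * x + r * z + (a + 3) * (q * z + r * y + a * (r * z)))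
        (p * z + q * y + r * x + (a + 3) * (r * z) + a * (q * z + r * y + a * (r * z))) := by
  simp only [quadraticCombination]
  push_cast
  linear_combination ((r : R) * z * θ + (q * z + r * y + a * (r * z))) * h

/-- The coordinates `(x, y, z)` describe an element of the simplicial cone spanned by
`1`, `θ²`, `(1 + θ)²`. -/
def InFirstCone (x y z : ℤ) : Prop := 0 ≤ y ∧ y ≤ 2 * x ∧ y ≤ 2 * z

/-- The coordinates `(x, y, z)` describe an element of the simplicial cone spanned by
`1`, `θ²`, `θ² / (1 + θ)²`. -/
def InSecondCone (a x y z : ℤ) : Prop :=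
  y ≤ 0 ∧ 0 ≤ (a ^ 2 + 3 * a + 3) * x - (a + 1) * y ∧ 0 ≤ (a ^ 2 + 3 * a + 3) * z + (a + 2) * y

theorem exists_totallyPositiveAssociated_inCone
    (h : θ ^ 3 = a * θ ^ 2 + (a + 3) * θ + 1)
    (hpos : ∀ x y z : ℤ, IsTotallyPositive ((quadraticCombination θ x y z : 𝓞 K) : K) →
      0 < x + z ∧ 0 < 2 * x - y + 2 * z)
    (hrep : ∀ β : 𝓞 K, ∃ x y z : ℤ, β = quadraticCombination θ x y z)
    {α : 𝓞 K} (hα : IsTotallyPositive (α : K)) :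
    ∃ x y z : ℤ, TotallyPositiveAssociated α (quadraticCombination θ x y z) ∧
      (InFirstCone x y z ∨ InSecondCone a x y z) := by
  classical
  let u : (𝓞 K)ˣ := ⟨θ, θ ^ 2 - a * θ - (a + 3), by linear_combination h,
    by linear_combination h⟩
  let v : (𝓞 K)ˣ := ⟨1 + θ, 2 + (a + 1) * θ - θ ^ 2, by linear_combination -h,
    by linear_combination -h⟩
  have hu : ((u : (𝓞 K)ˣ) : 𝓞 K) = θ := rfl
  have hu' : ((u⁻¹ : (𝓞 K)ˣ) : 𝓞 K) = θ ^ 2 - a * θ - (a + 3) := rfl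
  have hv : ((v : (𝓞 K)ˣ) : 𝓞 K) = 1 + θ := rfl
  have hv' : ((v⁻¹ : (𝓞 K)ˣ) : 𝓞 K) = 2 + (a + 1) * θ - θ ^ 2 := rfl
  -- The factor 2 gives both functionals the value 2 on the generators of their own cones, so that
  -- their values can be compared.
  let S (n : ℕ) : Prop := ∃ x y z : ℤ,
    TotallyPositiveAssociated α (quadraticCombination θ x y z) ∧
      ((n : ℤ) = 2 * x - y + 2 * z ∨ (n : ℤ) = 2 * (x + z))
  have hS : ∃ n, S n := by
    obtain ⟨x, y, z, e⟩ := hrep α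
    have := (hpos x y z (e ▸ hα)).1
    exact ⟨(2 * (x + z)).toNat, x, y, z, e ▸ .refl _, Or.inr (by omega)⟩
  obtain ⟨x, y, z, hxyz, hn⟩ := Nat.find_spec hS
  have hmin : ∀ x y z : ℤ, TotallyPositiveAssociated α (quadraticCombination θ x y z) →
      (Nat.find hS : ℤ) ≤ 2 * x - y + 2 * z ∧ (Nat.find hS : ℤ) ≤ 2 * (x + z) := by
    intro x y z H
    obtain ⟨h1, h2⟩ := hpos x y z (H.symm.isTotallyPositive hα)
    constructor
    · have := Nat.find_min' hS (m := (2 * x - y + 2 * z).toNat)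
        ⟨x, y, z, H, Or.inl (by omega)⟩
      omega
    · have := Nat.find_min' hS (m := (2 * (x + z)).toNat)
        ⟨x, y, z, H, Or.inr (by omega)⟩
      omega
  have move : ∀ (w : (𝓞 K)ˣ) (p q r : ℤ), (w : 𝓞 K) ^ 2 = quadraticCombination θ p q r →
      TotallyPositiveAssociated α
        (quadraticCombination θ p q r * quadraticCombination θ x y z) := by
    intro w p q r e
    refine hxyz.trans ?_
    rw [← e]
    exact (TotallyPositiveAssociated.unit_sq_mul w _).symm
  refine ⟨x, y, z, hxyz, ?_⟩
  have m0 := hmin x y z hxyz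
  rcases hn with hn | hn
  · left
    -- After multiplication by θ²/(1+θ)² and by 1/(1+θ)², L₁ becomes x - y + 2z and 2x - y + z;
    -- minimality of L₂ then gives y ≤ 2z and y ≤ 2x.
    have m1 := move (u * v⁻¹) (-(a + 1)) (-(a ^ 2 + 3 * a + 3)) (a + 2) (by
      rw [Units.val_mul, hu, hv']
      simp only [quadraticCombination]; push_cast
      linear_combination (θ ^ 2 * (θ - (a + 2)) + a * θ - (a + 1)) * h)
    have m2 := move v⁻¹ (2 - a) (-(a ^ 2 + a + 1)) a (by
      rw [hv']
      simp only [quadraticCombination]; push_cast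
      linear_combination (θ - (a + 2)) * h)
    rw [quadraticCombination_mul h] at m1 m2
    have m1 := (hmin _ _ _ m1).2
    have m2 := (hmin _ _ _ m2).2
    refine ⟨by linarith, ?_, ?_⟩ <;> linarith
  · right
    -- With D = a² + 3a + 3, L₂ becomes (D+2)x - (a+1)y + 2z here and 2x + (a+2)y + (D+2)z for `m2`;
    -- comparison with 2(x+z) gives the two remaining facets.
    have m1 := move (u⁻¹ * v) (a ^ 2 + 3 * a + 4) (a ^ 2 + a + 1) (-(a + 1)) (by
      rw [Units.val_mul, hu', hv]
      simp only [quadraticCombination]; push_cast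
      linear_combination (θ ^ 3 - a * θ ^ 2 - (a + 3) * θ - 1 +
        2 * (θ ^ 2 - a * θ - (a + 2)) + θ - a) * h)
    have m2 := move v 1 2 1 (by
      rw [hv]
      simp only [quadraticCombination]; push_cast
      ring)
    rw [quadraticCombination_mul h] at m1 m2
    have m1 := (hmin _ _ _ m1).1
    have m2 := (hmin _ _ _ m2).1
    refine ⟨by linarith, ?_, ?_⟩ <;> linarith

end Reduction

/-! ### Total positivity on the cones; indecomposables of the first cone. -/

section Cones

variable {K : Type*} [Field K] {a : ℤ} {θ : 𝓞 K}

/-- The generators are nonzero squares, so no list of the embeddings is needed. -/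
theorem isTotallyPositive_of_inFirstCone (h : θ ^ 3 = a * θ ^ 2 + (a + 3) * θ + 1) {x y z : ℤ}
    (hc : InFirstCone x y z) (h0 : 0 < 2 * x - y + 2 * z) :
    IsTotallyPositive ((quadraticCombination θ x y z : 𝓞 K) : K) := by
  obtain ⟨h1, h2, h3⟩ := hc
  have hθ : (θ : K) ^ 3 = a * (θ : K) ^ 2 + (a + 3) * θ + 1 := by
    simpa [map_ofNat] using congrArg (algebraMap (𝓞 K) K) h
  have n1 : (θ : K) ≠ 0 := fun e => by simp [e] at hθ
  have n2 : 1 + (θ : K) ≠ 0 := fun e => by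
    have e' : (θ : K) = -1 := by linear_combination e
    rw [e'] at hθ
    have : (1 : K) = 0 := by linear_combination hθ
    exact one_ne_zero this
  refine IsTotallyPositive.of_intCast_mul_eq (D := 2) (c₁ := 2 * x - y) (c₂ := 2 * z - y)
    (c₃ := y) isTotallyPositive_one (isTotallyPositive_sq n1) (isTotallyPositive_sq n2)
    (by norm_num) (by omega) (by omega) h1 (by omega) ?_
  simp only [quadraticCombination, map_add, map_mul, map_pow, map_intCast]
  push_cast
  ring

theorem isTotallyPositive_of_inSecondCone (h : θ ^ 3 = a * θ ^ 2 + (a + 3) * θ + 1) {x y z : ℤ}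
    (hc : InSecondCone a x y z) (h0 : 0 < x + z) :
    IsTotallyPositive ((quadraticCombination θ x y z : 𝓞 K) : K) := by
  obtain ⟨h1, h2, h3⟩ := hc
  have hθ : (θ : K) ^ 3 = a * (θ : K) ^ 2 + (a + 3) * θ + 1 := by
    simpa [map_ofNat] using congrArg (algebraMap (𝓞 K) K) h
  have n1 : (θ : K) ≠ 0 := fun e => by simp [e] at hθ
  have n2 : (2 + (a + 1) * θ - (θ : K) ^ 2) ≠ 0 := fun e => by
    have : (1 : K) = 0 := by linear_combination (1 + (θ : K)) * e + hθ
    exact one_ne_zero this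
  have hD : 0 < a ^ 2 + 3 * a + 3 := by nlinarith [sq_nonneg (2 * a + 3)]
  refine IsTotallyPositive.of_intCast_mul_eq (D := a ^ 2 + 3 * a + 3) isTotallyPositive_one
    (isTotallyPositive_sq n1) (isTotallyPositive_sq (mul_ne_zero n1 n2))
    hD h2 h3 (neg_nonneg.2 h1) (by nlinarith [mul_pos hD h0]) ?_
  simp only [quadraticCombination, map_add, map_mul, map_pow, map_intCast]
  push_cast
  linear_combination (y : K) * ((θ : K) ^ 2 * (θ - (a + 2)) + a * θ - (a + 1)) * hθ

theorem IsIndecomposable.not_isTotallyPositive_sub {x y z : ℤ}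
    (hi : IsIndecomposable (quadraticCombination θ x y z)) {p q r : ℤ}
    (hp : IsTotallyPositive ((quadraticCombination θ p q r : 𝓞 K) : K)) :
    ¬ IsTotallyPositive ((quadraticCombination θ (x - p) (y - q) (z - r) : 𝓞 K) : K) := by
  intro hs
  refine hi.2 ⟨_, _, hp, hs, ?_⟩
  simp only [quadraticCombination]
  push_cast
  ring

/-- In the coordinates 2x - y, 2z - y, y, which share one parity, each generator is twice a basis
vector. If no generator can be subtracted, all three are 0 or all are 1. -/
theorem eq_of_isIndecomposable_of_inFirstCone (h : θ ^ 3 = a * θ ^ 2 + (a + 3) * θ + 1)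
    {x y z : ℤ} (hc : InFirstCone x y z) (h0 : 0 < 2 * x - y + 2 * z)
    (hi : IsIndecomposable (quadraticCombination θ x y z)) :
    (x = 1 ∧ y = 0 ∧ z = 0) ∨ (x = 0 ∧ y = 0 ∧ z = 1) ∨ (x = 1 ∧ y = 2 ∧ z = 1) ∨
      (x = 1 ∧ y = 1 ∧ z = 1) := by
  by_contra hne
  obtain ⟨h1, h2, h3⟩ := hc
  have step : ∀ p q r : ℤ, InFirstCone p q r → 0 < 2 * p - q + 2 * r →
      InFirstCone (x - p) (y - q) (z - r) → 2 * (x - p) - (y - q) + 2 * (z - r) ≤ 0 := by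
    intro p q r e1 e2 e3
    by_contra! e4
    exact hi.not_isTotallyPositive_sub (isTotallyPositive_of_inFirstCone h e1 e2)
      (isTotallyPositive_of_inFirstCone h e3 e4)
  unfold InFirstCone at step
  have s1 := step 1 0 0
  have s2 := step 0 0 1
  have s3 := step 1 2 1
  omega

end Cones

/-! ### Lattice points at heights one and two in the second cone. -/

section LatticeTriangle

variable {a : ℤ}

/-- The lattice points of the triangle with vertices `1`, `θ²`, `θ² / (1 + θ)²`. -/
theorem InSecondCone.eq_or_bounds (ha : -1 ≤ a) {v w : ℤ}
    (hc : InSecondCone a (-v) (-w) (v + 1)) :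
    (v = -1 ∧ w = 0) ∨ (v = 0 ∧ w = 0) ∨ (v = a + 1 ∧ w = a ^ 2 + 3 * a + 3) ∨
      (0 ≤ v ∧ v ≤ a ∧ v * (a + 2) + 1 ≤ w ∧ w ≤ (v + 1) * (a + 1)) := by
  obtain ⟨h1, h2, h3⟩ := hc
  have hw : 0 ≤ w := by omega
  have hD : 0 < a ^ 2 + 3 * a + 3 := by nlinarith [sq_nonneg (2 * a + 3)]
  have hv : -1 ≤ v := by
    by_contra! hv
    nlinarith [mul_nonneg (by omega : 0 ≤ a + 2) hw, mul_pos hD (by omega : 0 < -v - 1)]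
  have hwD : w ≤ a ^ 2 + 3 * a + 3 := by nlinarith
  have hva : v ≤ a + 1 := by
    by_contra! hv
    nlinarith [mul_le_mul_of_nonneg_left hwD (by omega : 0 ≤ a + 1),
      mul_pos hD (by omega : 0 < v - (a + 1))]
  rcases eq_or_lt_of_le hv with rfl | hv
  · left; refine ⟨rfl, ?_⟩
    nlinarith
  rcases eq_or_lt_of_le hva with rfl | hva
  -- The factor a + 1 cannot be cancelled when a = -1; there the triangle contains only its
  -- vertices.
  · rcases eq_or_lt_of_le ha with rfl | ha
    · norm_num at *
      omega
    · right; right; left; refine ⟨rfl, le_antisymm hwD ?_⟩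
      have : (a + 1) * (a ^ 2 + 3 * a + 3) ≤ (a + 1) * w := by nlinarith
      exact le_of_mul_le_mul_left this (by omega)
  · by_cases h00 : v = 0 ∧ w = 0
    · exact Or.inr (Or.inl h00)
    right; right; right
    refine ⟨by omega, by omega, ?_, ?_⟩
    · by_contra! hlt
      have h4 : w ≤ v * (a + 2) := by omega
      have h5 := mul_le_mul_of_nonneg_left h4 (by omega : 0 ≤ a + 1)
      have h6 : v ≤ 0 := by nlinarith
      have h7 : v = 0 := by omega
      subst h7
      omega
    · by_contra! hlt
      have h4 : (v + 1) * (a + 1) + 1 ≤ w := by omega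
      have h5 := mul_le_mul_of_nonneg_left h4 (by omega : 0 ≤ a + 2)
      nlinarith

theorem inSecondCone_of_bounds {v w : ℤ} (hv : 0 ≤ v) (hva : v ≤ a) (h₁ : v * (a + 2) + 1 ≤ w)
    (h₂ : w ≤ (v + 1) * (a + 1)) : InSecondCone a (-v) (-w) (v + 1) := by
  refine ⟨?_, ?_, ?_⟩
  · nlinarith
  · nlinarith [mul_le_mul_of_nonneg_left h₁ (by omega : 0 ≤ a + 1)]
  · nlinarith [mul_le_mul_of_nonneg_left h₂ (by omega : 0 ≤ a + 2)]

/-- Lattice points of height two over the triangle that do not dominate a vertex. -/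
theorem InSecondCone.bounds_of_height_two (ha : -1 ≤ a) {V W : ℤ}
    (hc : InSecondCone a (-V) (-W) (V + 2))
    (h₁ : (a + 1) * W - V * (a ^ 2 + 3 * a + 3) < a ^ 2 + 3 * a + 3)
    (h₂ : (V + 2) * (a ^ 2 + 3 * a + 3) - (a + 2) * W < a ^ 2 + 3 * a + 3)
    (h₃ : W < a ^ 2 + 3 * a + 3) :
    0 ≤ V ∧ V ≤ a ∧ (V + 1) * (a + 1) + 1 ≤ W ∧ W ≤ (V + 1) * (a + 2) := by
  obtain ⟨c1, c2, -⟩ := hc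
  have hW : 0 ≤ W := by omega
  have hD : 0 < a ^ 2 + 3 * a + 3 := by nlinarith [sq_nonneg (2 * a + 3)]
  have hV : 0 ≤ V := by
    by_contra! hV
    nlinarith [mul_nonneg (by omega : 0 ≤ a + 1) hW, mul_nonneg hD.le (by omega : 0 ≤ -V - 1)]
  have hVa : V ≤ a := by
    by_contra! hV
    have e1 := mul_le_mul_of_nonneg_left (by omega : W ≤ a ^ 2 + 3 * a + 3 - 1)
      (by omega : 0 ≤ a + 1)
    have e2 := mul_nonneg hD.le (by omega : 0 ≤ V - (a + 1))
    have e3 : a + 1 ≤ 0 := by nlinarith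
    have e4 : a = -1 := by omega
    subst e4
    norm_num at *
    omega
  refine ⟨hV, hVa, ?_, ?_⟩
  · by_contra! hlt
    have h4 : W ≤ (V + 1) * (a + 1) := by omega
    have h5 := mul_le_mul_of_nonneg_left h4 (by omega : 0 ≤ a + 2)
    nlinarith
  · by_contra! hlt
    have h4 : (V + 1) * (a + 2) + 1 ≤ W := by omega
    have h5 := mul_le_mul_of_nonneg_left h4 (by omega : 0 ≤ a + 1)
    nlinarith

end LatticeTriangle

/-! ### Classification of the indecomposables by coordinates. -/

section Classification

variable {K : Type*} [Field K] {a : ℤ} {θ : 𝓞 K}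

theorem eq_of_isIndecomposable_of_inSecondCone (ha : -1 ≤ a)
    (h : θ ^ 3 = a * θ ^ 2 + (a + 3) * θ + 1)
    {x y z : ℤ} (hc : InSecondCone a x y z) (h0 : 0 < x + z)
    (hi : IsIndecomposable (quadraticCombination θ x y z)) : x + z = 1 := by
  by_contra hne
  have hD : 0 < a ^ 2 + 3 * a + 3 := by nlinarith [sq_nonneg (2 * a + 3)]
  obtain ⟨h1, h2, h3⟩ := id hc
  have step : ∀ p q r : ℤ, InSecondCone a p q r → p + r = 1 →
      ¬ InSecondCone a (x - p) (y - q) (z - r) := by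
    intro p q r e1 e2 e3
    exact hi.not_isTotallyPositive_sub (isTotallyPositive_of_inSecondCone h e1 (by omega))
      (isTotallyPositive_of_inSecondCone h e3 (by omega))
  have s1 : (a ^ 2 + 3 * a + 3) * x - (a + 1) * y < a ^ 2 + 3 * a + 3 := by
    by_contra! hlt
    refine step 1 0 0 ⟨le_rfl, by linarith, by linarith⟩ (by norm_num) ⟨?_, ?_, ?_⟩ <;> linarith
  have s2 : (a ^ 2 + 3 * a + 3) * z + (a + 2) * y < a ^ 2 + 3 * a + 3 := by
    by_contra! hlt
    refine step 0 0 1 ⟨le_rfl, by linarith, by linarith⟩ (by norm_num) ⟨?_, ?_, ?_⟩ <;> linarith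
  have s3 : -y < a ^ 2 + 3 * a + 3 := by
    by_contra! hlt
    refine step (-(a + 1)) (-(a ^ 2 + 3 * a + 3)) (a + 2)
      ⟨by linarith, by linarith, by linarith⟩ (by ring) ⟨?_, ?_, ?_⟩ <;> linarith
  have h5 : x + z = 2 := by
    -- The left sides of `s1`, `s2`, `s3` add up to (a² + 3a + 3)(x + z).
    have : x + z < 3 := by
      by_contra! h6
      nlinarith [mul_nonneg hD.le (by omega : 0 ≤ x + z - 3)]
    omega
  obtain ⟨V, rfl⟩ : ∃ V, x = -V := ⟨-x, by ring⟩
  obtain ⟨W, rfl⟩ : ∃ W, y = -W := ⟨-y, by ring⟩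
  obtain rfl : z = V + 2 := by omega
  obtain ⟨b1, b2, b3, b4⟩ := hc.bounds_of_height_two ha (by linarith) (by linarith) (by linarith)
  have hw : W - (V + 1) * (a + 1) ≤ V + 1 := by linarith
  -- The summand removed is the last point of row V; the remainder lies in row 0, since 1 ≤ W -
  -- (V+1)(a+1) ≤ V + 1 ≤ a + 1.
  refine step (-V) (-((V + 1) * (a + 1))) (V + 1)
    (inSecondCone_of_bounds b1 b2 (by nlinarith) le_rfl) (by ring) ?_
  convert inSecondCone_of_bounds (a := a) (v := 0) (w := W - (V + 1) * (a + 1)) le_rfl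
    (by omega) (by linarith) (by linarith) using 1 <;> ring

/-- A set of representatives of the indecomposables of `ℤ[θ]`. -/
def IsRepresentative (a x y z : ℤ) : Prop :=
  (x = 1 ∧ y = 0 ∧ z = 0) ∨ (x = 1 ∧ y = 1 ∧ z = 1) ∨
    ∃ v w : ℤ, 0 ≤ v ∧ v ≤ a ∧ v * (a + 2) + 1 ≤ w ∧ w ≤ (v + 1) * (a + 1) ∧
      x = -v ∧ y = -w ∧ z = v + 1

theorem exists_isRepresentative_of_isIndecomposable (ha : -1 ≤ a)
    (h : θ ^ 3 = a * θ ^ 2 + (a + 3) * θ + 1)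
    (hpos : ∀ x y z : ℤ, IsTotallyPositive ((quadraticCombination θ x y z : 𝓞 K) : K) →
      0 < x + z ∧ 0 < 2 * x - y + 2 * z)
    (hrep : ∀ β : 𝓞 K, ∃ x y z : ℤ, β = quadraticCombination θ x y z)
    {α : 𝓞 K} (hα : IsIndecomposable α) :
    ∃ x y z : ℤ, TotallyPositiveAssociated α (quadraticCombination θ x y z) ∧
      IsRepresentative a x y z := by
  let u : (𝓞 K)ˣ := ⟨θ, θ ^ 2 - a * θ - (a + 3), by linear_combination h,
    by linear_combination h⟩
  let v : (𝓞 K)ˣ := ⟨1 + θ, 2 + (a + 1) * θ - θ ^ 2, by linear_combination -h,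
    by linear_combination -h⟩
  have hu : ((u : (𝓞 K)ˣ) : 𝓞 K) = θ := rfl
  have hv : ((v : (𝓞 K)ˣ) : 𝓞 K) = 1 + θ := rfl
  have hv' : ((v⁻¹ : (𝓞 K)ˣ) : 𝓞 K) = 2 + (a + 1) * θ - θ ^ 2 := rfl
  obtain ⟨x, y, z, hxyz, hcone⟩ := exists_totallyPositiveAssociated_inCone h hpos hrep hα.1
  have hi := hxyz.symm.isIndecomposable hα
  obtain ⟨p1, p2⟩ := hpos x y z hi.1
  have unit_case : ∀ w : (𝓞 K)ˣ, quadraticCombination θ x y z = (w : 𝓞 K) ^ 2 →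
      ∃ x y z : ℤ, TotallyPositiveAssociated α (quadraticCombination θ x y z) ∧
        IsRepresentative a x y z := by
    intro w hw
    refine ⟨1, 0, 0, hxyz.trans ?_, Or.inl ⟨rfl, rfl, rfl⟩⟩
    rw [hw]
    simpa [quadraticCombination] using TotallyPositiveAssociated.unit_sq_mul w 1
  have theta_sq : quadraticCombination θ 0 0 1 = (u : 𝓞 K) ^ 2 := by
    rw [hu]; simp [quadraticCombination]
  rcases hcone with hcone | hcone
  · rcases eq_of_isIndecomposable_of_inFirstCone h hcone p2 hi with
      ⟨rfl, rfl, rfl⟩ | ⟨rfl, rfl, rfl⟩ | ⟨rfl, rfl, rfl⟩ | ⟨rfl, rfl, rfl⟩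
    · exact ⟨1, 0, 0, hxyz, Or.inl ⟨rfl, rfl, rfl⟩⟩
    · exact unit_case u theta_sq
    · refine unit_case v ?_
      rw [hv]; simp only [quadraticCombination]; push_cast; ring
    · exact ⟨1, 1, 1, hxyz, Or.inr (Or.inl ⟨rfl, rfl, rfl⟩)⟩
  · have h1 := eq_of_isIndecomposable_of_inSecondCone ha h hcone p1 hi
    obtain ⟨V, rfl⟩ : ∃ V, x = -V := ⟨-x, by ring⟩
    obtain ⟨W, rfl⟩ : ∃ W, y = -W := ⟨-y, by ring⟩
    obtain rfl : z = V + 1 := by omega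
    rcases hcone.eq_or_bounds ha with ⟨rfl, rfl⟩ | ⟨rfl, rfl⟩ | ⟨rfl, rfl⟩ | ⟨b1, b2, b3, b4⟩
    · exact ⟨1, 0, 0, by simpa using hxyz, Or.inl ⟨rfl, rfl, rfl⟩⟩
    · exact unit_case u (by simpa using theta_sq)
    · refine unit_case (u * v⁻¹) ?_
      rw [Units.val_mul, hu, hv']
      simp only [quadraticCombination]; push_cast
      linear_combination -(θ ^ 2 * (θ - (a + 2)) + a * θ - (a + 1)) * h
    · exact ⟨-V, -W, V + 1, hxyz, Or.inr (Or.inr ⟨V, W, b1, b2, b3, b4, rfl, rfl, rfl⟩)⟩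

/-- A decomposition splits L₁ into positive integers, which is impossible when L₁ = 1. For 1 + θ +
θ², both parts have L₁ = 1, and L₂ forces the middle coordinates to be 0 and 1, the case excluded by
`hsplit`. -/
theorem isIndecomposable_of_isRepresentative
    (h : θ ^ 3 = a * θ ^ 2 + (a + 3) * θ + 1)
    (hpos : ∀ x y z : ℤ, IsTotallyPositive ((quadraticCombination θ x y z : 𝓞 K) : K) →
      0 < x + z ∧ 0 < 2 * x - y + 2 * z)
    (hrep : ∀ β : 𝓞 K, ∃ x y z : ℤ, β = quadraticCombination θ x y z)
    (hinj : ∀ x y z x' y' z' : ℤ, quadraticCombination θ x y z = quadraticCombination θ x' y' z' →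
      x = x' ∧ y = y' ∧ z = z')
    (hsplit : ∀ v : ℤ, IsTotallyPositive ((quadraticCombination θ (-v) 0 (v + 1) : 𝓞 K) : K) →
      ¬ IsTotallyPositive ((quadraticCombination θ (v + 1) 1 (-v) : 𝓞 K) : K))
    {x y z : ℤ} (hxyz : IsRepresentative a x y z) :
    IsIndecomposable (quadraticCombination θ x y z) := by
  have decompose : ∀ β γ : 𝓞 K, IsTotallyPositive (β : K) → IsTotallyPositive (γ : K) →
      quadraticCombination θ x y z = β + γ → ∃ p q r : ℤ,
        IsTotallyPositive ((quadraticCombination θ p q r : 𝓞 K) : K) ∧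
        IsTotallyPositive ((quadraticCombination θ (x - p) (y - q) (z - r) : 𝓞 K) : K) := by
    intro β γ hβ hγ e
    obtain ⟨p, q, r, rfl⟩ := hrep β
    obtain ⟨p', q', r', rfl⟩ := hrep γ
    obtain ⟨rfl, rfl, rfl⟩ := hinj x y z (p + p') (q + q') (r + r') (by
      rw [e]; simp only [quadraticCombination]; push_cast; ring)
    exact ⟨p, q, r, hβ, by simpa using hγ⟩
  refine ⟨?_, ?_⟩
  · rcases hxyz with ⟨rfl, rfl, rfl⟩ | ⟨rfl, rfl, rfl⟩ | ⟨v, w, h1, h2, h3, h4, rfl, rfl, rfl⟩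
    · exact isTotallyPositive_of_inFirstCone h ⟨by norm_num, by norm_num, by norm_num⟩
        (by norm_num)
    · exact isTotallyPositive_of_inFirstCone h ⟨by norm_num, by norm_num, by norm_num⟩
        (by norm_num)
    · exact isTotallyPositive_of_inSecondCone h (inSecondCone_of_bounds h1 h2 h3 h4) (by omega)
  · rintro ⟨β, γ, hβ, hγ, e⟩
    obtain ⟨p, q, r, h1, h2⟩ := decompose β γ hβ hγ e
    have b1 := hpos _ _ _ h1
    have b2 := hpos _ _ _ h2
    rcases hxyz with ⟨rfl, rfl, rfl⟩ | ⟨rfl, rfl, rfl⟩ | ⟨v, w, -, -, -, -, rfl, rfl, rfl⟩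
    · omega
    · obtain ⟨v, rfl⟩ : ∃ v, p = -v := ⟨-p, by ring⟩
      obtain rfl : r = v + 1 := by omega
      rcases (by omega : q = 0 ∨ q = 1) with rfl | rfl
      · refine hsplit v h1 ?_
        convert h2 using 3 <;> ring
      · refine hsplit (-v - 1) ?_ ?_
        · convert h2 using 3 <;> ring
        · convert h1 using 3 <;> ring
    · omega

end Classification

open Polynomial in
/-- The simplest cubic polynomial `X³ - a X² - (a + 3) X - 1`. -/
noncomputable def simplestCubic (a : ℤ) : Polynomial ℚ :=
  X ^ 3 - C (a : ℚ) * X ^ 2 - C ((a : ℚ) + 3) * X - 1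

/-! ### Irreducibility of the cubic. -/

section SimplestCubic

open Polynomial

theorem simplestCubic_natDegree (a : ℤ) : (simplestCubic a).natDegree = 3 := by
  unfold simplestCubic; compute_degree!

theorem simplestCubic_monic (a : ℤ) : (simplestCubic a).Monic := by
  unfold simplestCubic; monicity!

theorem simplestCubic_aeval (a : ℤ) {A : Type*} [CommRing A] [Algebra ℚ A] (x : A) :
    aeval x (simplestCubic a) = x ^ 3 - a * x ^ 2 - (a + 3) * x - 1 := by
  simp [simplestCubic, map_ofNat]

theorem simplestCubic_irreducible (a : ℤ) : Irreducible (simplestCubic a) := by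
  refine irreducible_of_degree_le_three_of_not_isRoot (by simp [simplestCubic_natDegree]) ?_
  intro q hq
  have hq' : q ^ 3 - a * q ^ 2 - (a + 3) * q - 1 = 0 := by
    rw [← simplestCubic_aeval a q, aeval_def, eval₂_eq_eval_map]
    simpa [IsRoot] using hq
  have hint : IsIntegral ℤ q := by
    refine ⟨X ^ 3 - C a * X ^ 2 - C (a + 3) * X - 1, by monicity!, ?_⟩
    rw [← aeval_def]
    simpa [map_ofNat] using hq'
  obtain ⟨m, rfl⟩ := IsIntegrallyClosed.isIntegral_iff.1 hint
  have hm : m ^ 3 - a * m ^ 2 - (a + 3) * m - 1 = 0 := by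
    have : ((m ^ 3 - a * m ^ 2 - (a + 3) * m - 1 : ℤ) : ℚ) = 0 := by
      push_cast; simpa using hq'
    exact_mod_cast this
  have hu : m * (m ^ 2 - a * m - (a + 3)) = 1 := by linear_combination hm
  rcases Int.isUnit_iff.1 (IsUnit.of_mul_eq_one _ hu) with rfl | rfl <;> omega

end SimplestCubic

/-! ### Real conjugates and trace identities. -/

section RealRoots

variable {a : ℤ} {ρ : ℝ}

theorem IsSimplestCubicRoot.one_lt (ha : -1 ≤ a) (hρ : IsSimplestCubicRoot a ρ) : 1 < ρ := by
  have ha' : (-1 : ℝ) ≤ a := by exact_mod_cast ha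
  have hcont : ContinuousOn (fun x : ℝ => x ^ 3 - (a : ℝ) * x ^ 2 - ((a : ℝ) + 3) * x - 1)
      (Set.Icc 1 (a + 3)) := by fun_prop
  obtain ⟨c, hc, hc0⟩ := intermediate_value_Icc (by linarith : (1 : ℝ) ≤ a + 3) hcont
    (show (0 : ℝ) ∈ _ from ⟨by norm_num; linarith, by nlinarith⟩)
  have h1 : c ≠ 1 := by
    rintro rfl
    norm_num at hc0
    linarith
  exact (lt_of_le_of_ne hc.1 h1.symm).trans_le (hρ.2 hc0)

theorem exists_ringHom_simplestCubic (hρ : IsSimplestCubicRoot a ρ) {s : ℝ}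
    (hs : s ^ 3 - (a : ℝ) * s ^ 2 - ((a : ℝ) + 3) * s - 1 = 0) :
    ∃ σ : ℚ⟮ρ⟯ →+* ℝ, σ (IntermediateField.AdjoinSimple.gen ℚ ρ) = s := by
  have hmin : minpoly ℚ ρ = simplestCubic a :=
    (minpoly.eq_of_irreducible_of_monic (simplestCubic_irreducible a)
      (by rw [simplestCubic_aeval]; exact hρ.1) (simplestCubic_monic a)).symm
  have hint : IsIntegral ℚ ρ :=
    ⟨simplestCubic a, simplestCubic_monic a, by
      rw [← Polynomial.aeval_def, simplestCubic_aeval]; exact hρ.1⟩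
  have hroot : s ∈ (minpoly ℚ ρ).aroots ℝ := by
    rw [Polynomial.mem_aroots, hmin]
    exact ⟨(simplestCubic_monic a).ne_zero, by rw [simplestCubic_aeval]; exact hs⟩
  exact ⟨((IntermediateField.algHomAdjoinIntegralEquiv ℚ hint).symm ⟨s, hroot⟩).toRingHom,
    IntermediateField.algHomAdjoinIntegralEquiv_symm_apply_gen ℚ hint ⟨s, hroot⟩⟩

variable {r : ℝ}

theorem simplestCubic_conj_two (hr : 1 < r)
    (h : r ^ 3 - (a : ℝ) * r ^ 2 - ((a : ℝ) + 3) * r - 1 = 0) :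
    (-(1 + r) / r) ^ 3 - (a : ℝ) * (-(1 + r) / r) ^ 2 - ((a : ℝ) + 3) * (-(1 + r) / r) - 1 = 0 := by
  have : r ≠ 0 := by positivity
  field_simp
  linear_combination h

theorem simplestCubic_conj_three (hr : 1 < r)
    (h : r ^ 3 - (a : ℝ) * r ^ 2 - ((a : ℝ) + 3) * r - 1 = 0) :
    (-1 / (1 + r)) ^ 3 - (a : ℝ) * (-1 / (1 + r)) ^ 2 - ((a : ℝ) + 3) * (-1 / (1 + r)) - 1 = 0 := by
  have : 1 + r ≠ 0 := by positivity
  field_simp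
  linear_combination -h

/-- The coordinate functional `x + z` is a positive combination of the conjugates. -/
theorem trace_identity_one (hr : 1 < r) (x y z : ℝ) :
    (r ^ 2 + r + 1) ^ 2 * (x + z) =
      (1 + r) ^ 2 * (x + y * r + z * r ^ 2) +
      r ^ 2 * (x + y * (-(1 + r) / r) + z * (-(1 + r) / r) ^ 2) +
      r ^ 2 * (1 + r) ^ 2 * (x + y * (-1 / (1 + r)) + z * (-1 / (1 + r)) ^ 2) := by
  have : r ≠ 0 := by positivity
  have : 1 + r ≠ 0 := by positivity
  field_simp
  ring

/-- Divided by r² + r + 1, the weights are the values of 1/(s² + s + 1) at the three roots s. -/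
theorem trace_identity_two (hr : 1 < r) (x y z : ℝ) :
    (r ^ 2 + r + 1) * (2 * x - y + 2 * z) =
      (x + y * r + z * r ^ 2) +
      r ^ 2 * (x + y * (-(1 + r) / r) + z * (-(1 + r) / r) ^ 2) +
      (1 + r) ^ 2 * (x + y * (-1 / (1 + r)) + z * (-1 / (1 + r)) ^ 2) := by
  have : r ≠ 0 := by positivity
  have : 1 + r ≠ 0 := by positivity
  field_simp
  ring

end RealRoots

/-! ### Transfer to the field generated by ρ. -/

section Field

variable {a : ℤ} {ρ : ℝ}

theorem exists_eq_quadraticCombination_of_mem_adjoin {R : Type*} [CommRing R] {θ : R}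
    (h : θ ^ 3 = a * θ ^ 2 + (a + 3) * θ + 1) {β : R} (hβ : β ∈ Algebra.adjoin ℤ {θ}) :
    ∃ x y z : ℤ, β = quadraticCombination θ x y z := by
  induction hβ using Algebra.adjoin_induction with
  | mem s hs =>
    obtain rfl := hs
    exact ⟨0, 1, 0, by simp [quadraticCombination]⟩
  | algebraMap n => exact ⟨n, 0, 0, by simp [quadraticCombination]⟩
  | add s t _ _ hs ht =>
    obtain ⟨x, y, z, rfl⟩ := hs
    obtain ⟨x', y', z', rfl⟩ := ht
    exact ⟨x + x', y + y', z + z', by simp only [quadraticCombination]; push_cast; ring⟩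
  | mul s t _ _ hs ht =>
    obtain ⟨x, y, z, rfl⟩ := hs
    obtain ⟨x', y', z', rfl⟩ := ht
    exact ⟨_, _, _, quadraticCombination_mul h _ _ _ _ _ _⟩

theorem algebraMap_quadraticCombination {K : Type*} [Field K] (θ : 𝓞 K) (x y z : ℤ) :
    ((quadraticCombination θ x y z : 𝓞 K) : K) = quadraticCombination (θ : K) x y z := by
  simp [quadraticCombination]

theorem map_quadraticCombination {R S : Type*} [CommRing R] [CommRing S] (f : R →+* S) (θ : R)
    (x y z : ℤ) : f (quadraticCombination θ x y z) = x + y * f θ + z * f θ ^ 2 := by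
  simp [quadraticCombination]

theorem gen_pow_three (hρ : IsSimplestCubicRoot a ρ) :
    (IntermediateField.AdjoinSimple.gen ℚ ρ) ^ 3 =
      a * (IntermediateField.AdjoinSimple.gen ℚ ρ) ^ 2 +
        (a + 3) * IntermediateField.AdjoinSimple.gen ℚ ρ + 1 := by
  apply (algebraMap ℚ⟮ρ⟯ ℝ).injective
  have : ρ ^ 3 - (a : ℝ) * ρ ^ 2 - ((a : ℝ) + 3) * ρ - 1 = 0 := hρ.1
  simp only [map_add, map_mul, map_pow, map_intCast, map_one, map_ofNat,
    IntermediateField.AdjoinSimple.algebraMap_gen]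
  linear_combination this

/-- The three conjugates of a totally positive element of `ℤ[ρ]` are positive. -/
theorem conjugates_pos (ha : -1 ≤ a) (hρ : IsSimplestCubicRoot a ρ) {x y z : ℤ}
    (h : IsTotallyPositive (quadraticCombination (IntermediateField.AdjoinSimple.gen ℚ ρ) x y z)) :
    0 < x + y * ρ + z * ρ ^ 2 ∧ 0 < x + y * (-(1 + ρ) / ρ) + z * (-(1 + ρ) / ρ) ^ 2 ∧
      0 < x + y * (-1 / (1 + ρ)) + z * (-1 / (1 + ρ)) ^ 2 := by
  have hr := hρ.one_lt ha
  have key : ∀ s : ℝ, s ^ 3 - (a : ℝ) * s ^ 2 - ((a : ℝ) + 3) * s - 1 = 0 →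
      0 < x + y * s + z * s ^ 2 := by
    intro s hs
    obtain ⟨σ, rfl⟩ := exists_ringHom_simplestCubic hρ hs
    rw [← map_quadraticCombination]
    exact h σ
  exact ⟨key _ hρ.1, key _ (simplestCubic_conj_two hr hρ.1),
    key _ (simplestCubic_conj_three hr hρ.1)⟩

theorem functionals_pos (ha : -1 ≤ a) (hρ : IsSimplestCubicRoot a ρ) {x y z : ℤ}
    (h : IsTotallyPositive (quadraticCombination (IntermediateField.AdjoinSimple.gen ℚ ρ) x y z)) :
    0 < x + z ∧ 0 < 2 * x - y + 2 * z := by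
  have hr := hρ.one_lt ha
  obtain ⟨h1, h2, h3⟩ := conjugates_pos ha hρ h
  constructor
  · have e := trace_identity_one hr (x : ℝ) y z
    have : (0 : ℝ) < x + z := by
      refine pos_of_mul_pos_right (a := (ρ ^ 2 + ρ + 1) ^ 2) ?_ (by positivity)
      rw [e]
      positivity
    exact_mod_cast this
  · have e := trace_identity_two hr (x : ℝ) y z
    have : (0 : ℝ) < 2 * x - y + 2 * z := by
      refine pos_of_mul_pos_right (a := (ρ ^ 2 + ρ + 1)) ?_ (by positivity)
      rw [e]
      positivity
    exact_mod_cast this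

theorem quadraticCombination_gen_injective (ha : -1 ≤ a) (hρ : IsSimplestCubicRoot a ρ)
    {x y z x' y' z' : ℤ}
    (h : quadraticCombination (IntermediateField.AdjoinSimple.gen ℚ ρ) x y z =
      quadraticCombination (IntermediateField.AdjoinSimple.gen ℚ ρ) x' y' z') :
    x = x' ∧ y = y' ∧ z = z' := by
  have hr := hρ.one_lt ha
  have key : ∀ s : ℝ, s ^ 3 - (a : ℝ) * s ^ 2 - ((a : ℝ) + 3) * s - 1 = 0 →
      ((x - x' : ℤ) : ℝ) + (y - y' : ℤ) * s + (z - z' : ℤ) * s ^ 2 = 0 := by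
    intro s hs
    obtain ⟨σ, rfl⟩ := exists_ringHom_simplestCubic hρ hs
    have := congrArg σ h
    rw [map_quadraticCombination, map_quadraticCombination] at this
    push_cast
    linear_combination this
  have h1 := key _ hρ.1
  have h2 := key _ (simplestCubic_conj_two hr hρ.1)
  have h3 := key _ (simplestCubic_conj_three hr hρ.1)
  have e1 := trace_identity_one hr ((x - x' : ℤ) : ℝ) (y - y' : ℤ) (z - z' : ℤ)
  have e2 := trace_identity_two hr ((x - x' : ℤ) : ℝ) (y - y' : ℤ) (z - z' : ℤ)
  rw [h1, h2, h3] at e1 e2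
  have q0 : ρ ^ 2 + ρ + 1 ≠ 0 := by positivity
  have f1 : ((x - x' : ℤ) : ℝ) + (z - z' : ℤ) = 0 := by simpa [q0] using e1
  have f2 : 2 * ((x - x' : ℤ) : ℝ) - (y - y' : ℤ) + 2 * (z - z' : ℤ) = 0 := by
    have : (ρ ^ 2 + ρ + 1) * (2 * ((x - x' : ℤ) : ℝ) - (y - y' : ℤ) + 2 * (z - z' : ℤ)) = 0 := by
      linear_combination e2
    exact (mul_eq_zero.1 this).resolve_left q0
  -- Once both functionals vanish, x = -z and y = 0 in the differences, and ρ > 1 kills the last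
  -- coordinate.
  have f3 : (ρ ^ 2 - 1) * ((z - z' : ℤ) : ℝ) = 0 := by
    linear_combination h1 - f1 - ρ * (2 * f1 - f2)
  have f4 : ((z - z' : ℤ) : ℝ) = 0 := (mul_eq_zero.1 f3).resolve_left (by nlinarith)
  have g1 : x - x' + (z - z') = 0 := by exact_mod_cast f1
  have g2 : 2 * (x - x') - (y - y') + 2 * (z - z') = 0 := by exact_mod_cast f2
  have g3 : z - z' = 0 := by exact_mod_cast f4
  omega

/-- The element `1 + ρ + ρ²` is not the sum of two totally positive elements of trace one. -/
theorem not_isTotallyPositive_complement (ha : -1 ≤ a) (hρ : IsSimplestCubicRoot a ρ) {v : ℤ}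
    (h : IsTotallyPositive
      (quadraticCombination (IntermediateField.AdjoinSimple.gen ℚ ρ) (-v) 0 (v + 1))) :
    ¬ IsTotallyPositive
      (quadraticCombination (IntermediateField.AdjoinSimple.gen ℚ ρ) (v + 1) 1 (-v)) := by
  intro h'
  have hr := hρ.one_lt ha
  obtain ⟨p1, p2, p3⟩ := conjugates_pos ha hρ h
  obtain ⟨-, q2, q3⟩ := conjugates_pos ha hρ h'
  have hr0 : ρ ≠ 0 := by positivity
  have hr1 : 1 + ρ ≠ 0 := by positivity
  push_cast at p1 p2 p3 q2 q3
  rcases (by omega : v = 0 ∨ v = -1 ∨ 1 ≤ v ∨ v ≤ -2) with rfl | rfl | hv | hv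
  -- Here 1 + θ is negative at the second conjugate; for v = -1, θ + θ² is negative at the third.
  · have : (-(1 + ρ) / ρ) = -1 - 1 / ρ := by field_simp; ring
    have h1 : 0 < 1 / ρ := by positivity
    rw [this] at q2
    push_cast at q2
    linarith
  · have e : (-1 / (1 + ρ)) = -(1 / (1 + ρ)) := by ring
    have h1 : 0 < 1 / (1 + ρ) := by positivity
    have h2 : 1 / (1 + ρ) < 1 := by rw [div_lt_one (by positivity)]; linarith
    rw [e] at q3
    push_cast at q3
    nlinarith
  -- The third conjugate s has s² < 1/4, so -v + (v+1)s² < 0.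
  · have hv' : (1 : ℝ) ≤ v := by exact_mod_cast hv
    have e : (-1 / (1 + ρ)) ^ 2 < 1 / 4 := by
      rw [div_pow, div_lt_div_iff₀ (by positivity) (by norm_num)]
      nlinarith
    nlinarith
  -- Positivity bounds the squares of the first two conjugates by v/(v+1) ≤ 2; but (1+ρ)² < 2ρ² and
  -- ρ² < 2 are incompatible for ρ > 1.
  · have hv' : (v : ℝ) ≤ -2 := by exact_mod_cast hv
    have p1' : ρ ^ 2 < 2 := by nlinarith
    have p2' : (-(1 + ρ) / ρ) ^ 2 < 2 := by nlinarith
    rw [div_pow, div_lt_iff₀ (by positivity)] at p2'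
    nlinarith

end Field

theorem theorem1p2 (a : ℤ) (ha : -1 ≤ a) (ρ : ℝ) (hρ : IsSimplestCubicRoot a ρ)
    (hO : integralClosure ℤ ℚ⟮ρ⟯ =
      Algebra.adjoin ℤ {IntermediateField.AdjoinSimple.gen ℚ ρ}) :
    ∀ α : 𝓞 ℚ⟮ρ⟯, IsIndecomposable α ↔
      ∃ ε : (𝓞 ℚ⟮ρ⟯)ˣ, IsTotallyPositive (((ε : 𝓞 ℚ⟮ρ⟯)) : ℚ⟮ρ⟯) ∧
        ∃ x ∈ simplestCubicList a (IntermediateField.AdjoinSimple.gen ℚ ρ),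
          (α : ℚ⟮ρ⟯) = ((ε : 𝓞 ℚ⟮ρ⟯) : ℚ⟮ρ⟯) * x := by
  intro α
  have hgen : IntermediateField.AdjoinSimple.gen ℚ ρ ∈ integralClosure ℤ ℚ⟮ρ⟯ :=
    hO ▸ Algebra.subset_adjoin rfl
  let θ : 𝓞 ℚ⟮ρ⟯ := ⟨IntermediateField.AdjoinSimple.gen ℚ ρ, hgen⟩
  have hθ : (θ : ℚ⟮ρ⟯) = IntermediateField.AdjoinSimple.gen ℚ ρ := rfl
  have hcoe : ∀ x y z : ℤ, ((quadraticCombination θ x y z : 𝓞 ℚ⟮ρ⟯) : ℚ⟮ρ⟯) =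
      quadraticCombination (IntermediateField.AdjoinSimple.gen ℚ ρ) x y z :=
    algebraMap_quadraticCombination θ
  have h : θ ^ 3 = a * θ ^ 2 + (a + 3) * θ + 1 := by
    apply NumberField.RingOfIntegers.coe_injective
    simpa [map_ofNat, hθ] using gen_pow_three hρ
  have hrep : ∀ β : 𝓞 ℚ⟮ρ⟯, ∃ x y z : ℤ, β = quadraticCombination θ x y z := by
    intro β
    obtain ⟨x, y, z, e⟩ := exists_eq_quadraticCombination_of_mem_adjoin (gen_pow_three hρ)
      (hO ▸ β.2 : (β : ℚ⟮ρ⟯) ∈ _)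
    exact ⟨x, y, z, NumberField.RingOfIntegers.coe_injective (e.trans (hcoe x y z).symm)⟩
  have hpos : ∀ x y z : ℤ,
      IsTotallyPositive ((quadraticCombination θ x y z : 𝓞 ℚ⟮ρ⟯) : ℚ⟮ρ⟯) →
        0 < x + z ∧ 0 < 2 * x - y + 2 * z := by
    intro x y z hx
    rw [hcoe] at hx
    exact functionals_pos ha hρ hx
  have hlist : ∀ t : ℚ⟮ρ⟯,
      t ∈ simplestCubicList a (IntermediateField.AdjoinSimple.gen ℚ ρ) ↔ ∃ x y z : ℤ,
        IsRepresentative a x y z ∧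
          t = quadraticCombination (IntermediateField.AdjoinSimple.gen ℚ ρ) x y z := by
    intro t
    constructor
    · rintro ((rfl | rfl) | ⟨v, w, h1, h2, h3, h4, rfl⟩)
      · exact ⟨1, 0, 0, Or.inl ⟨rfl, rfl, rfl⟩, by simp [quadraticCombination]⟩
      · exact ⟨1, 1, 1, Or.inr (Or.inl ⟨rfl, rfl, rfl⟩), by simp [quadraticCombination]⟩
      · refine ⟨-v, -w, v + 1, Or.inr (Or.inr ⟨v, w, h1, h2, h3, h4, rfl, rfl, rfl⟩), ?_⟩
        simp only [quadraticCombination]; push_cast; ring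
    · rintro ⟨x, y, z, ⟨rfl, rfl, rfl⟩ | ⟨rfl, rfl, rfl⟩ |
        ⟨v, w, h1, h2, h3, h4, rfl, rfl, rfl⟩, rfl⟩
      · exact Or.inl (Or.inl (by simp [quadraticCombination]))
      · exact Or.inl (Or.inr (by simp [quadraticCombination]))
      · refine Or.inr ⟨v, w, h1, h2, h3, h4, ?_⟩
        simp only [quadraticCombination]; push_cast; ring
  constructor
  · intro hα
    obtain ⟨x, y, z, ⟨ε, hε, e⟩, hxyz⟩ :=
      exists_isRepresentative_of_isIndecomposable ha h hpos hrep hα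
    refine ⟨ε, hε, _, (hlist _).2 ⟨x, y, z, hxyz, rfl⟩, ?_⟩
    rw [e, ← hcoe]
    exact map_mul (algebraMap (𝓞 ℚ⟮ρ⟯) ℚ⟮ρ⟯) _ _
  · rintro ⟨ε, hε, t, ht, e⟩
    obtain ⟨x, y, z, hxyz, rfl⟩ := (hlist t).1 ht
    have hassoc : TotallyPositiveAssociated α (quadraticCombination θ x y z) := by
      refine ⟨ε, hε, NumberField.RingOfIntegers.coe_injective ?_⟩
      rw [← hcoe] at e
      exact e.trans (map_mul (algebraMap (𝓞 ℚ⟮ρ⟯) ℚ⟮ρ⟯) _ _).symm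
    refine hassoc.isIndecomposable
      (isIndecomposable_of_isRepresentative h hpos hrep ?_ ?_ hxyz)
    · intro x y z x' y' z' e
      refine quadraticCombination_gen_injective ha hρ ?_
      rw [← hcoe, ← hcoe, e]
    · intro v hv
      rw [hcoe] at hv ⊢
      exact not_isTotallyPositive_complement ha hρ hv
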